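/- Let $\Omega\subset\mathbb C$ be open, let $0\le k<1$, and let $\mathcal H:\mathbb C\to\mathbb C$ be $k$-Lipschitz, i.e. $|\mathcal H(\xi_1)-\mathcal H(\xi_2)|\le k|\xi_1-\xi_2|$ for all $\xi_1,\xi_2\in\mathbb C$. Let $F\in W^{1,2}_{\mathrm{loc}}(\Omega,\mathbb C)$, with weak differential $DF(z)$ (a real-linear map $\mathbb C\to\mathbb C$ for a.e. $z\in\Omega$), solve the autonomous nonlinear Beltrami equation $$\partial_{\bar z}F(z)=\mathcal H(\partial_z F(z))\qquad\text{for a.e. } z\in\Omega,$$ where $\partial_z=\tfrac12(\partial_x-i\partial_y)$ and $\partial_{\bar z}=\tfrac12(\partial_x+i\partial_y)$. Then for every $e\in\mathbb C$ with $|e|=1$ the directional derivative $\partial_eF(z)=DF(z)e$ belongs to $W^{1,2}_{\mathrm{loc}}(\Omega,\mathbb C)$ and is $K$-quasiregular in $\Omega$ with $K=\frac{1+k}{1-k}$. Here a map $g\in W^{1,2}_{\mathrm{loc}}(\Omega,\mathbb C)$ is called $K$-quasiregular ($K\ge1$) if $|Dg(z)|^2\le K\,J(z,g)$ for a.e. $z\in\Omega$,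 where $|Dg(z)|$ is the operator norm of the weak differential and $J(z,g)=\det Dg(z)$ its Jacobian determinant. -/

import Mathlib

open MeasureTheory
open scoped ContDiff NNReal

namespace Beltrami

/-- `f ∈ L²_loc(Ω)`: `f` is square integrable on every compact subset of `Ω`. -/
def MemL2loc {E : Type*} [NormedAddCommGroup E] (Ω : Set ℂ) (f : ℂ → E) : Prop :=
  ∀ C : Set ℂ, C ⊆ Ω → IsCompact C → MemLp f 2 (volume.restrict C)

/-- `g` is the weak derivative of `f` in `Ω` in the direction `e`:
`∫ (∂_e φ) f = - ∫ φ g` for every test function `φ ∈ C_c^∞(Ω)`. As `φ` and its derivative vanish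
outside `Ω`, the values of `f` and `g` outside `Ω` play no role. -/
def HasWeakDirDeriv (Ω : Set ℂ) (f g : ℂ → ℂ) (e : ℂ) : Prop :=
  ∀ φ : ℂ → ℝ, ContDiff ℝ ∞ φ → HasCompactSupport φ → tsupport φ ⊆ Ω →
    ∫ z, (fderiv ℝ φ z e) • f z = -∫ z, φ z • g z

/-- `f ∈ W^{1,2}_loc(Ω, ℂ)` with weak differential `Df`; the value `Df z` is the real linear map
`e ↦ ∂_e f (z)`. -/
structure HasW12locDifferential (Ω : Set ℂ) (f : ℂ → ℂ) (Df : ℂ → ℂ →L[ℝ] ℂ) : Prop where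
  memL2loc : MemL2loc Ω f
  memL2loc_differential : MemL2loc Ω Df
  hasWeakDirDeriv : ∀ e : ℂ, HasWeakDirDeriv Ω f (fun z => Df z e) e

/-- The local Sobolev space `W^{1,2}_loc(Ω, ℂ)`. -/
def MemW12loc (Ω : Set ℂ) (f : ℂ → ℂ) : Prop :=
  ∃ Df : ℂ → ℂ →L[ℝ] ℂ, HasW12locDifferential Ω f Df

/-- The Wirtinger derivative `∂_z = (∂_x - i ∂_y) / 2`, read off a real differential. -/
noncomputable def dz (L : ℂ →L[ℝ] ℂ) : ℂ := (L 1 - Complex.I * L Complex.I) / 2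

/-- The Wirtinger derivative `∂_{z̄} = (∂_x + i ∂_y) / 2`, read off a real differential. -/
noncomputable def dzbar (L : ℂ →L[ℝ] ℂ) : ℂ := (L 1 + Complex.I * L Complex.I) / 2

/-- `g` is `K`-quasiregular in `Ω`: `g ∈ W^{1,2}_loc(Ω, ℂ)` and `|Dg|² ≤ K J(·, g)` almost
everywhere in `Ω`, where `|Dg|` is the operator norm and `J(·, g)` the Jacobian determinant.
(The weak differential is unique up to null sets.) -/
def IsQuasiregular (K : ℝ) (Ω : Set ℂ) (g : ℂ → ℂ) : Prop :=
  1 ≤ K ∧ ∃ Dg : ℂ → ℂ →L[ℝ] ℂ, HasW12locDifferential Ω g Dg ∧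
    ∀ᵐ z ∂(volume.restrict Ω), ‖Dg z‖ ^ 2 ≤ K * (Dg z).det

end Beltrami

namespace Beltrami

open Filter Topology Set

/-! Since `H` does not depend on `z`, a difference `w(z) = F(z + te) - F(z)` of two solutions
satisfies `|∂_z̄ w| ≤ k |∂_z w|`. For a function on the plane with gradient in `L²`, `‖∂_z u‖ =
‖∂_z̄ u‖`, because the Jacobian is a null Lagrangian (`inner_eq_inner_of_hasWeakDirDeriv`). Applied
to `u = ηw`, this absorbs the `∂_z̄` term as `k < 1` and leaves a Caccioppoli bound of `η ∂_z w` by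
`‖w‖ = O(t)` (`caccioppoli`).

Hence `∂_z F` and `∂_z̄ F` have bounded difference quotients (`exists_bound_difference_wirtinger`),
so weak derivatives `a`, `b` in direction `e` (`MemL2loc.exists_hasWeakDirDeriv`). Passing to the
limit in the Lipschitz inequality gives `|b| ≤ k |a|` (`ae_norm_le_of_lipschitz`). Weak derivatives
commute, so `a` and `b` are the Wirtinger derivatives of `∂_e F`, and `|b| ≤ k |a|` yields the
distortion inequality. -/

/-- The Hilbert space of square integrable functions on the plane. -/
abbrev L2 : Type := Lp ℂ 2 (volume : Measure ℂ)

/-! ### Translations of `L²`. -/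

/-- Translation on `L²(ℂ)`, `f ↦ f (a + ·)`, as a linear isometry. -/
noncomputable def translate (a : ℂ) : L2 →ₗᵢ[ℂ] L2 where
  toFun f := DomAddAct.mk a +ᵥ f
  map_add' f g := DomAddAct.vadd_Lp_add _ f g
  map_smul' c f := by
    rcases f with ⟨⟨f⟩, hf⟩
    rfl
  norm_map' f := DomAddAct.norm_vadd_Lp _ f

theorem translate_ae_eq (a : ℂ) (f : L2) : translate a f =ᵐ[volume] fun z => f (a + z) :=
  DomAddAct.vadd_Lp_ae_eq _ _

theorem memLp_translate {f : ℂ → ℂ} (hf : MemLp f 2 volume) (a : ℂ) :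
    MemLp (fun z => f (a + z)) 2 volume :=
  hf.comp_measurePreserving (measurePreserving_add_left volume a)

theorem translate_toLp {f : ℂ → ℂ} (hf : MemLp f 2 volume) (a : ℂ) :
    translate a (hf.toLp f) = (memLp_translate hf a).toLp _ := rfl

theorem translate_translate (a b : ℂ) (f : L2) :
    translate a (translate b f) = translate (a + b) f := by
  change DomAddAct.mk a +ᵥ (DomAddAct.mk b +ᵥ f) = DomAddAct.mk (a + b) +ᵥ f
  rw [vadd_vadd, ← DomAddAct.mk_add, add_comm]

theorem translate_zero (f : L2) : translate 0 f = f := by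
  change DomAddAct.mk (0 : ℂ) +ᵥ f = f
  rw [DomAddAct.mk_zero, zero_vadd]

theorem inner_translate_left (a : ℂ) (f g : L2) :
    inner ℂ (translate a f) g = inner ℂ f (translate (-a) g) := by
  rw [← (translate (-a)).inner_map_map, translate_translate, neg_add_cancel, translate_zero]

theorem continuous_translate (f : L2) : Continuous fun a : ℂ => translate a f := by
  have : Fact ((2 : ENNReal) ≠ ⊤) := ⟨by norm_num⟩
  have : Continuous fun a : ℂ => DomAddAct.mk a +ᵥ f :=
    (DomAddAct.continuous_mk (M := ℂ)).vadd continuous_const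
  exact this

/-! ### Test functions and their pairing with `L²`. -/

/-- Test functions on `Ω`. -/
structure IsTest (Ω : Set ℂ) (φ : ℂ → ℝ) : Prop where
  contDiff : ContDiff ℝ ∞ φ
  hasCompactSupport : HasCompactSupport φ
  tsupport_subset : tsupport φ ⊆ Ω

namespace IsTest

variable {Ω : Set ℂ} {φ : ℂ → ℝ}

theorem mono (h : IsTest Ω φ) {Ω' : Set ℂ} (hΩ : tsupport φ ⊆ Ω') : IsTest Ω' φ :=
  ⟨h.1, h.2, hΩ⟩

theorem univ (h : IsTest Ω φ) : IsTest univ φ := h.mono (subset_univ _)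

theorem continuous (h : IsTest Ω φ) : Continuous φ := h.contDiff.continuous

theorem mul (h : IsTest Ω φ) {ψ : ℂ → ℝ} (hψ : ContDiff ℝ ∞ ψ) :
    IsTest Ω (fun z => φ z * ψ z) :=
  ⟨h.1.mul hψ, h.2.mul_right, (tsupport_mul_subset_left).trans h.3⟩

theorem fderiv_apply (h : IsTest Ω φ) (e : ℂ) : IsTest Ω (fun z => fderiv ℝ φ z e) := by
  exact ⟨(h.1.fderiv_right (m := ∞) (by simp)).clm_apply contDiff_const,
    h.2.fderiv_apply (𝕜 := ℝ) e, (tsupport_fderiv_apply_subset ℝ e).trans h.3⟩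

theorem memLp (h : IsTest Ω φ) : MemLp (fun z => (φ z : ℂ)) 2 volume :=
  (Complex.continuous_ofReal.comp h.continuous).memLp_of_hasCompactSupport
    (h.2.comp_left Complex.ofReal_zero)

/-- A test function as an element of `L²(ℂ)`. -/
noncomputable def toL2 (h : IsTest Ω φ) : L2 := h.memLp.toLp _

theorem inner_toL2 (h : IsTest Ω φ) (f : L2) : inner ℂ h.toL2 f = ∫ z, φ z • f z := by
  rw [L2.inner_def]
  refine integral_congr_ae ?_
  filter_upwards [h.memLp.coeFn_toLp] with z hz
  rw [toL2, hz]
  simp [mul_comm]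

theorem inner_toL2_translate (h : IsTest Ω φ) (a : ℂ) (f : L2) :
    inner ℂ h.toL2 (translate a f) = ∫ z, φ z • f (a + z) := by
  rw [h.inner_toL2]
  refine integral_congr_ae ?_
  filter_upwards [translate_ae_eq a f] with z hz
  rw [hz]

end IsTest

theorem locallyIntegrable_L2 (f : L2) : LocallyIntegrable f volume :=
  (Lp.memLp f).locallyIntegrable (by norm_num)

theorem L2.eq_zero_of_inner_test {f : L2}
    (h : ∀ (φ : ℂ → ℝ) (hφ : IsTest univ φ), inner ℂ hφ.toL2 f = 0) : f = 0 := by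
  rw [Lp.eq_zero_iff_ae_eq_zero]
  refine ae_eq_zero_of_integral_contDiff_smul_eq_zero (locallyIntegrable_L2 f) fun φ h1 h2 => ?_
  rw [← IsTest.inner_toL2 ⟨h1, h2, subset_univ _⟩]
  exact h φ _

/-! ### Weak derivatives and difference quotients on the whole plane. -/

/-- Differentiating a pairing with a test function along a line of translations. -/
theorem hasDerivAt_integral_test_smul {f : ℂ → ℂ} (hf : LocallyIntegrable f volume)
    {φ : ℂ → ℝ} (hφ : IsTest univ φ) (e : ℂ) (t : ℝ) :
    HasDerivAt (fun t : ℝ => ∫ z, φ z • f (t • e + z))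
      (-∫ z, fderiv ℝ φ z e • f (t • e + z)) t := by
  set L : ℂ →L[ℝ] ℝ →L[ℝ] ℂ := (ContinuousLinearMap.lsmul ℝ ℝ).flip with hL
  -- Reflecting `φ` turns the pairing into a convolution, which is differentiated on its smooth
  -- factor; the reflection produces the minus sign.
  set ψ : ℂ → ℝ := fun z => φ (-z) with hψ
  have hψc : HasCompactSupport ψ := hφ.2.comp_homeomorph (Homeomorph.neg ℂ)
  have hψd : ContDiff ℝ ∞ ψ := hφ.1.comp contDiff_neg
  have key : ∀ (ρ : ℂ → ℝ) (x : ℂ), ∫ z, ρ z • f (x + z)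
      = (convolution f (fun z => ρ (-z)) L volume) x := by
    intro ρ x
    change _ = ∫ t, L (f t) (ρ (-(x - t)))
    rw [← integral_add_left_eq_self (fun t => L (f t) (ρ (-(x - t)))) x]
    simp [hL]
  have hd := hψc.hasFDerivAt_convolution_right L hf (hψd.of_le (by simp)) (t • e)
  have hline : HasDerivAt (fun t : ℝ => t • e) e t := by
    simpa using (hasDerivAt_id t).smul_const e
  have h := hd.comp_hasDerivAt t hline
  rw [convolution_precompR_apply L hf (hψc.fderiv ℝ) (hψd.continuous_fderiv (by simp))] at h
  have h1 : (fun t : ℝ => ∫ z, φ z • f (t • e + z)) =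
      (convolution f ψ L volume) ∘ fun t : ℝ => t • e := by
    ext t; exact key φ _
  rw [h1, key (fun z => fderiv ℝ φ z e)]
  refine h.congr_deriv ?_
  change ∫ z, L (f z) (fderiv ℝ ψ (t • e - z) e) = -(∫ z, L (f z) (fderiv ℝ φ (-(t • e - z)) e))
  rw [← integral_neg]
  congr 1
  ext z
  have : fderiv ℝ ψ (t • e - z) = - fderiv ℝ φ (-(t • e - z)) := by
    have h2 := ((hφ.1.differentiable (by simp)) (-(t • e - z))).hasFDerivAt.comp (t • e - z)
      (hasFDerivAt_id (𝕜 := ℝ) (t • e - z)).neg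
    rw [show ψ = φ ∘ Neg.neg from rfl, h2.fderiv]
    ext y
    simp
  rw [this]
  simp [hL]

theorem HasWeakDirDeriv.congr_ae {f f' g g' : ℂ → ℂ} {Ω : Set ℂ} {e : ℂ}
    (h : HasWeakDirDeriv Ω f g e) (hf : f =ᵐ[volume] f') (hg : g =ᵐ[volume] g') :
    HasWeakDirDeriv Ω f' g' e := by
  intro φ h1 h2 h3
  have e1 : ∫ z, (fderiv ℝ φ z e) • f' z = ∫ z, (fderiv ℝ φ z e) • f z :=
    integral_congr_ae (by filter_upwards [hf] with z hz; rw [hz])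
  have e2 : ∫ z, φ z • g' z = ∫ z, φ z • g z :=
    integral_congr_ae (by filter_upwards [hg] with z hz; rw [hz])
  rw [e1, e2, h φ h1 h2 h3]

theorem HasWeakDirDeriv.translate {f g : ℂ → ℂ} {e : ℂ}
    (h : HasWeakDirDeriv univ f g e) (a : ℂ) :
    HasWeakDirDeriv univ (fun z => f (a + z)) (fun z => g (a + z)) e := by
  intro φ h1 h2 _
  have key := h (fun z => φ (z - a)) (h1.comp (contDiff_id.sub contDiff_const))
    (h2.comp_homeomorph (Homeomorph.subRight a)) (subset_univ _)
  rw [← integral_add_left_eq_self (fun z => (fderiv ℝ (fun z => φ (z - a)) z e) • f z) a,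
    ← integral_add_left_eq_self (fun z => φ (z - a) • g z) a] at key
  simpa [fderiv_comp_sub] using key

/-- The translates of an `L²` function with a weak derivative in `L²` are obtained by integrating
the translates of the derivative. -/
theorem translate_eq_add_integral {u v : L2} {e : ℂ} (h : HasWeakDirDeriv univ u v e) (t : ℝ) :
    translate (t • e) u = u + ∫ s in (0 : ℝ)..t, translate (s • e) v := by
  have hc : Continuous fun s : ℝ => Beltrami.translate (s • e) v :=
    (continuous_translate v).comp (continuous_id.smul continuous_const)
  rw [← sub_eq_zero]
  refine L2.eq_zero_of_inner_test fun φ hφ => ?_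
  set ℓ : L2 →L[ℝ] ℂ := (innerSL ℂ hφ.toL2).restrictScalars ℝ with hℓ
  have h1 : ∀ s : ℝ, HasDerivAt (fun s : ℝ => ℓ (Beltrami.translate (s • e) u))
      (ℓ (Beltrami.translate (s • e) v)) s := by
    intro s
    have h2 := hasDerivAt_integral_test_smul (locallyIntegrable_L2 u) hφ e s
    rw [(h.translate (s • e)) φ hφ.1 hφ.2 hφ.3, neg_neg, ← hφ.inner_toL2_translate] at h2
    simp only [← hφ.inner_toL2_translate] at h2
    exact h2
  -- Tested against `φ`, both sides have the same derivative in `s` and agree at `s = 0`.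
  have h3 : ∀ s : ℝ, HasDerivAt (fun s : ℝ => ℓ (Beltrami.translate (s • e) u -
      (u + ∫ r in (0 : ℝ)..s, Beltrami.translate (r • e) v))) 0 s := by
    intro s
    have h4 : HasDerivAt (fun s : ℝ => ∫ r in (0 : ℝ)..s, Beltrami.translate (r • e) v)
        (Beltrami.translate (s • e) v) s :=
      intervalIntegral.integral_hasDerivAt_right (hc.intervalIntegrable _ _)
        (hc.stronglyMeasurableAtFilter _ _) hc.continuousAt
    have h5 := (h1 s).sub ((ℓ.hasFDerivAt.comp_hasDerivAt s h4).const_add (ℓ u))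
    rw [sub_self] at h5
    refine h5.congr_of_eventuallyEq (Eventually.of_forall fun s => ?_)
    simp [map_sub, map_add]
  have h6 := is_const_of_deriv_eq_zero (fun s => (h3 s).differentiableAt) (fun s => (h3 s).deriv)
    t 0
  simpa [hℓ, translate_zero] using h6

/-- Translations are isometries, so the integrand has constant norm `‖v‖`. This is the source of the
factor `|t|` in the final estimate. -/
theorem norm_translate_sub_le {u v : L2} {e : ℂ} (h : HasWeakDirDeriv univ u v e) (t : ℝ) :
    ‖translate (t • e) u - u‖ ≤ |t| * ‖v‖ := by
  rw [translate_eq_add_integral h, add_sub_cancel_left]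
  have := intervalIntegral.norm_integral_le_of_norm_le_const (a := 0) (b := t) (C := ‖v‖)
    (f := fun s : ℝ => Beltrami.translate (s • e) v) fun s _ => by simp
  simpa [mul_comm] using this

theorem hasDerivAt_translate {u v : L2} {e : ℂ} (h : HasWeakDirDeriv univ u v e) :
    HasDerivAt (fun t : ℝ => translate (t • e) u) v 0 := by
  have hc : Continuous fun s : ℝ => Beltrami.translate (s • e) v :=
    (continuous_translate v).comp (continuous_id.smul continuous_const)
  have h4 : HasDerivAt (fun s : ℝ => ∫ r in (0 : ℝ)..s, Beltrami.translate (r • e) v)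
      (Beltrami.translate ((0 : ℝ) • e) v) 0 :=
    intervalIntegral.integral_hasDerivAt_right (hc.intervalIntegrable _ _)
      (hc.stronglyMeasurableAtFilter _ _) hc.continuousAt
  have h5 := h4.const_add u
  rw [zero_smul, translate_zero] at h5
  rwa [show (fun t : ℝ => Beltrami.translate (t • e) u) = _ from
    funext fun t => translate_eq_add_integral h t]

theorem tendsto_difference_quotient {u v : L2} {e : ℂ} (h : HasWeakDirDeriv univ u v e) :
    Tendsto (fun t : ℝ => t⁻¹ • (translate (t • e) u - u)) (𝓝[≠] 0) (𝓝 v) := by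
  simpa [translate_zero] using hasDerivAt_iff_tendsto_slope_zero.1 (hasDerivAt_translate h)

/-- An `L²` function whose difference quotients are bounded in `L²` has a weak derivative
in `L²`. -/
theorem exists_hasWeakDirDeriv {u : L2} {e : ℂ} {C : ℝ}
    (h : ∀ᶠ t : ℝ in 𝓝[≠] 0, ‖translate (t • e) u - u‖ ≤ C * |t|) :
    ∃ v : L2, HasWeakDirDeriv univ u v e := by
  let q : ℝ → L2 := fun t => t⁻¹ • (Beltrami.translate (t • e) u - u)
  let d : ℝ → WeakDual ℂ L2 := fun t =>
    StrongDual.toWeakDual (InnerProductSpace.toDual ℂ L2 (q t))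
  have hq : ∀ᶠ t : ℝ in 𝓝[≠] 0, ‖q t‖ ≤ C := by
    filter_upwards [h, self_mem_nhdsWithin] with t ht ht0
    have : 0 < |t| := abs_pos.2 ht0
    rw [norm_smul, norm_inv, Real.norm_eq_abs, inv_mul_le_iff₀ this]
    linarith
  -- Banach–Alaoglu: along an ultrafilter finer than `𝓝[≠] 0` the bounded quotients converge weakly,
  -- with no subsequence to extract.
  let 𝒰 : Ultrafilter ℝ := Ultrafilter.of (𝓝[≠] (0 : ℝ))
  have h𝒰 : (𝒰 : Filter ℝ) ≤ 𝓝[≠] 0 := Ultrafilter.of_le _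
  have hK := WeakDual.isCompact_closedBall (𝕜 := ℂ) (E := L2) 0 C
  obtain ⟨ℓ, -, hℓ⟩ := hK.ultrafilter_le_nhds (𝒰.map d) (by
    rw [le_principal_iff]
    refine h𝒰 ?_
    filter_upwards [hq] with t ht
    simpa [d] using ht)
  let v : L2 := (InnerProductSpace.toDual ℂ L2).symm (WeakDual.toStrongDual ℓ)
  refine ⟨v, fun φ h1 h2 h3 => ?_⟩
  have hφ : IsTest univ φ := ⟨h1, h2, h3⟩
  have t1 : Tendsto (fun t => inner ℂ (q t) hφ.toL2) 𝒰 (𝓝 (inner ℂ v hφ.toL2)) := by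
    have := ((WeakDual.eval_continuous (𝕜 := ℂ) hφ.toL2).tendsto ℓ).comp
      (show Tendsto d 𝒰 (𝓝 ℓ) from hℓ)
    simpa [Function.comp_def, d, v] using this
  have t2 : Tendsto (fun t => inner ℂ hφ.toL2 (q t)) 𝒰 (𝓝 (inner ℂ hφ.toL2 v)) := by
    simpa [Function.comp_def, inner_conj_symm] using
      (Complex.continuous_conj.tendsto _).comp t1
  have t3 := hasDerivAt_iff_tendsto_slope_zero.1
    (hasDerivAt_integral_test_smul (locallyIntegrable_L2 u) hφ e 0)
  -- The same pairings converge along the full filter, with the derivative falling on `φ`; comparing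
  -- the limits identifies `v`.
  have t4 : Tendsto (fun t => inner ℂ hφ.toL2 (q t)) (𝓝[≠] 0)
      (𝓝 (-∫ z, fderiv ℝ φ z e • u z)) := by
    simp only [zero_add, zero_smul, ← hφ.inner_toL2_translate, ← hφ.inner_toL2] at t3
    refine t3.congr fun t => ?_
    rw [show q t = ((t⁻¹ : ℝ) : ℂ) • (Beltrami.translate (t • e) u - u) from
      (Complex.coe_smul _ _).symm, inner_smul_right, inner_sub_right]
    simp
  have := tendsto_nhds_unique t2 (t4.mono_left h𝒰)
  rw [hφ.inner_toL2] at this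
  rw [this, neg_neg]

/-! ### The null Lagrangian identity. -/

/-- The Jacobian is a null Lagrangian. -/
theorem inner_eq_inner_of_hasWeakDirDeriv {u p q : L2} {e e' : ℂ}
    (hp : HasWeakDirDeriv univ u p e) (hq : HasWeakDirDeriv univ u q e') :
    inner ℂ p q = inner ℂ q p := by
  -- The adjoint of `τ_a - 1` is `τ_{-a} - 1` and translations commute. So pairing the `e` and `e'`
  -- quotients at step `t` equals pairing the `e'` and `e` quotients at step `-t`; then `t → 0`.
  have hneg : Tendsto (fun t : ℝ => -t) (𝓝[≠] 0) (𝓝[≠] 0) := by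
    refine tendsto_nhdsWithin_of_tendsto_nhds_of_eventually_within _ ?_ ?_
    · simpa using (continuous_neg.tendsto (0 : ℝ)).mono_left nhdsWithin_le_nhds
    · filter_upwards [self_mem_nhdsWithin] with t ht
      simpa using ht
  have t1 := (tendsto_difference_quotient hp).inner (𝕜 := ℂ) (tendsto_difference_quotient hq)
  have t2 := ((tendsto_difference_quotient hq).inner (𝕜 := ℂ)
    (tendsto_difference_quotient hp)).comp hneg
  refine tendsto_nhds_unique t1 (t2.congr fun t => ?_)
  have hs : ∀ w : L2, t⁻¹ • w = ((t⁻¹ : ℝ) : ℂ) • w := fun w => (Complex.coe_smul _ _).symm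
  have hs' : ∀ w : L2, (-t)⁻¹ • w = (((-t)⁻¹ : ℝ) : ℂ) • w := fun w => (Complex.coe_smul _ _).symm
  simp only [Function.comp_apply, hs, hs', inner_smul_left, inner_smul_right, inner_sub_left,
    inner_sub_right, inner_translate_left, translate_translate, Complex.conj_ofReal]
  rw [show -(-t • e') + -t • e = -(t • e) + t • e' by simp [add_comm]]
  simp only [neg_smul, neg_neg]
  push_cast
  ring

/-- This is `‖∂_z u‖ = ‖∂_z̄ u‖`: the squared norms differ only by a multiple of `Re ⟨p, iq⟩`, which
vanishes because `⟨p, q⟩` is real. -/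
theorem norm_sub_I_smul_eq {u p q : L2} (hp : HasWeakDirDeriv univ u p 1)
    (hq : HasWeakDirDeriv univ u q Complex.I) :
    ‖p - Complex.I • q‖ = ‖p + Complex.I • q‖ := by
  have h := inner_eq_inner_of_hasWeakDirDeriv hp hq
  have h1 : RCLike.re (inner ℂ p (Complex.I • q)) = 0 := by
    have h2 : (starRingEnd ℂ) (inner ℂ p q) = inner ℂ p q := by rw [inner_conj_symm, h]
    rw [inner_smul_right]
    simpa using Complex.conj_eq_iff_im.1 h2
  rw [← sq_eq_sq₀ (norm_nonneg _) (norm_nonneg _), @norm_sub_sq ℂ, @norm_add_sq ℂ, h1]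
  ring

/-! ### Cutoffs, localisation and gluing of weak derivatives. -/

variable {Ω : Set ℂ} {η φ : ℂ → ℝ} {f g a b : ℂ → ℂ} {e : ℂ}

theorem IsTest.exists_abs_le (hη : IsTest Ω η) : ∃ M : ℝ, ∀ z, |η z| ≤ M :=
  hη.2.exists_bound_of_continuous hη.continuous

theorem IsTest.exists_abs_sub_le (hη : IsTest Ω η) :
    ∃ M : ℝ, ∀ x y, |η x - η y| ≤ M * ‖x - y‖ := by
  obtain ⟨M, hM⟩ := (hη.2.fderiv ℝ).exists_bound_of_continuous
    (hη.1.continuous_fderiv (by simp))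
  exact ⟨M, fun x y => convex_univ.norm_image_sub_le_of_norm_fderiv_le (𝕜 := ℝ)
    (fun z _ => hη.1.differentiable (by simp) z) (fun z _ => hM z) (mem_univ y) (mem_univ x)⟩

theorem IsTest.support_smul_subset (φ : ℂ → ℝ) (f : ℂ → ℂ) :
    Function.support (fun z => φ z • f z) ⊆ tsupport φ :=
  (Function.support_smul_subset_left φ f).trans (subset_tsupport φ)

theorem IsTest.memLp_smul (hη : IsTest Ω η) (hf : MemL2loc Ω f) :
    MemLp (fun z => η z • f z) 2 volume := by
  have hm : MeasurableSet (tsupport η) := (isClosed_tsupport η).measurableSet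
  have h1 := hf _ hη.3 hη.2
  obtain ⟨M, hM⟩ := hη.exists_abs_le
  have h2 : MemLp (fun z => η z • f z) 2 (volume.restrict (tsupport η)) := by
    refine h1.of_le_mul (c := M)
      (hη.continuous.aestronglyMeasurable.smul h1.aestronglyMeasurable)
      (Eventually.of_forall fun z => ?_)
    rw [norm_smul]
    exact mul_le_mul_of_nonneg_right (hM z) (norm_nonneg _)
  rw [← memLp_indicator_iff_restrict hm] at h2
  rwa [indicator_eq_self.2 (IsTest.support_smul_subset η f)] at h2

theorem IsTest.integrable_smul (hη : IsTest Ω η) (hf : MemL2loc Ω f) :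
    Integrable (fun z => η z • f z) volume := by
  rw [← integrableOn_iff_integrable_of_support_subset (IsTest.support_smul_subset η f)]
  have : Fact (volume (tsupport η) < ⊤) := ⟨hη.2.isCompact.measure_lt_top⟩
  exact ((hη.memLp_smul hf).restrict _).integrable (by norm_num)

theorem MemL2loc.of_memLp (hf : MemLp f 2 volume) : MemL2loc Ω f := fun _ _ _ => hf.restrict _

theorem MemL2loc.add (hf : MemL2loc Ω f) (hg : MemL2loc Ω g) :
    MemL2loc Ω (fun z => f z + g z) := fun C hC hC' => (hf C hC hC').add (hg C hC hC')

theorem MemL2loc.const_mul (hf : MemL2loc Ω f) (c : ℂ) :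
    MemL2loc Ω (fun z => c * f z) := fun C hC hC' => (hf C hC hC').const_mul c

theorem MemL2loc.clm_apply {D : ℂ → ℂ →L[ℝ] ℂ} (hD : MemL2loc Ω D) (e : ℂ) :
    MemL2loc Ω (fun z => D z e) := fun C hC hC' =>
  (ContinuousLinearMap.apply ℝ ℂ e).comp_memLp' (hD C hC hC')

theorem HasWeakDirDeriv.const_mul (h : HasWeakDirDeriv Ω f a e) (c : ℂ) :
    HasWeakDirDeriv Ω (fun z => c * f z) (fun z => c * a z) e := by
  intro φ h1 h2 h3
  have key := congrArg (c * ·) (h φ h1 h2 h3)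
  simp only [Complex.real_smul, mul_neg, ← integral_const_mul] at key ⊢
  simpa only [mul_left_comm c] using key

theorem HasWeakDirDeriv.add (hf : MemL2loc Ω f) (hg : MemL2loc Ω g) (ha : MemL2loc Ω a)
    (hb : MemL2loc Ω b) (h : HasWeakDirDeriv Ω f a e) (h' : HasWeakDirDeriv Ω g b e) :
    HasWeakDirDeriv Ω (fun z => f z + g z) (fun z => a z + b z) e := by
  intro φ h1 h2 h3
  have hφ : IsTest Ω φ := ⟨h1, h2, h3⟩
  simp only [smul_add]
  rw [integral_add ((hφ.fderiv_apply e).integrable_smul hf)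
    ((hφ.fderiv_apply e).integrable_smul hg), h φ h1 h2 h3, h' φ h1 h2 h3,
    integral_add (hφ.integrable_smul ha) (hφ.integrable_smul hb)]
  ring

/-- The product rule for a test function and a weakly differentiable function. -/
theorem HasWeakDirDeriv.test_smul (hf : MemL2loc Ω f) (ha : MemL2loc Ω a)
    (h : HasWeakDirDeriv Ω f a e) (hη : IsTest Ω η) :
    HasWeakDirDeriv univ (fun z => η z • f z) (fun z => η z • a z + fderiv ℝ η z e • f z) e := by
  intro φ h1 h2 h3
  have hφ : IsTest univ φ := ⟨h1, h2, h3⟩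
  -- `ηφ` is admissible on `Ω` wherever `φ` is supported, so the product is weakly differentiable on
  -- the whole plane.
  have hθ := hη.mul h1
  have key := h _ hθ.1 hθ.2 hθ.3
  have hd : ∀ z, fderiv ℝ (fun z => η z * φ z) z e • f z =
      (η z * fderiv ℝ φ z e) • f z + (fderiv ℝ η z e * φ z) • f z := by
    intro z
    rw [fderiv_fun_mul (hη.1.differentiable (by simp) z) (h1.differentiable (by simp) z)]
    simp only [add_apply, smul_apply, smul_eq_mul,
      ← add_smul]
    ring_nf
  have i1 := (hη.mul (hφ.fderiv_apply e).1).integrable_smul hf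
  have i2 := ((hη.fderiv_apply e).mul h1).integrable_smul hf
  have i3 := hθ.integrable_smul ha
  simp only [hd] at key
  rw [integral_add i1 i2] at key
  have e1 : ∀ z, fderiv ℝ φ z e • η z • f z = (η z * fderiv ℝ φ z e) • f z := fun z => by
    rw [smul_smul, mul_comm]
  have e2 : ∀ z, φ z • (η z • a z + fderiv ℝ η z e • f z) =
      (η z * φ z) • a z + (fderiv ℝ η z e * φ z) • f z := fun z => by
    rw [smul_add, smul_smul, smul_smul, mul_comm, mul_comm (φ z)]
  simp only [e1, e2]
  rw [integral_add i3 i2, neg_add, ← key]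
  ring

theorem IsTest.memLp_smul_add (hη : IsTest Ω η) (hf : MemL2loc Ω f) (ha : MemL2loc Ω a) (e : ℂ) :
    MemLp (fun z => η z • a z + fderiv ℝ η z e • f z) 2 volume :=
  (hη.memLp_smul ha).add ((hη.fderiv_apply e).memLp_smul hf)

/-- Smooth cutoff functions. -/
theorem exists_isTest_eq_one {K : Set ℂ} (hΩ : IsOpen Ω) (hK : IsCompact K) (hKΩ : K ⊆ Ω) :
    ∃ (η : ℂ → ℝ) (U : Set ℂ), IsTest Ω η ∧ IsOpen U ∧ K ⊆ U ∧ U ⊆ Ω ∧ ∀ z ∈ U, η z = 1 := by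
  -- Two nested neighbourhoods: `η` is `1` on the open set `V`, so its derivative vanishes there,
  -- and its support is `W`.
  obtain ⟨V, hV, hKV, hVΩ, hVc⟩ := exists_open_between_and_isCompact_closure hK hΩ hKΩ
  obtain ⟨W, hW, hVW, hWΩ, hWc⟩ := exists_open_between_and_isCompact_closure hVc hΩ hVΩ
  obtain ⟨η, h1, -, h3, h4⟩ := exists_contMDiff_support_eq_eq_one_iff (n := ⊤)
    (modelWithCornersSelf ℝ ℂ) hW isClosed_closure hVW
  refine ⟨η, V, ⟨h1.contDiff, ?_, ?_⟩, hV, hKV, subset_closure.trans hVΩ,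
    fun z hz => (h4 z).1 (subset_closure hz)⟩
  · rw [HasCompactSupport, tsupport, h3]
    exact hWc
  · rw [tsupport, h3]
    exact hWΩ

theorem fderiv_eq_zero_of_eq_one {U : Set ℂ} (hU : IsOpen U) (h : ∀ z ∈ U, η z = 1) {z : ℂ}
    (hz : z ∈ U) : fderiv ℝ η z = 0 := by
  have : η =ᶠ[𝓝 z] fun _ => (1 : ℝ) := by
    filter_upwards [hU.mem_nhds hz] with y hy using h y hy
  rw [this.fderiv_eq]
  simp

/-- Restriction of a weak derivative to a set on which a cutoff function is `1`. -/
theorem HasWeakDirDeriv.of_cutoff {U : Set ℂ} (h1 : ∀ z ∈ U, η z = 1)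
    (h : HasWeakDirDeriv univ (fun z => η z • f z) a e) : HasWeakDirDeriv U f a e := by
  intro φ g1 g2 g3
  rw [← h φ g1 g2 (subset_univ _)]
  congr 1
  ext z
  by_cases hz : z ∈ U
  · simp [h1 z hz]
  · have : fderiv ℝ φ z = 0 := by
      by_contra hne
      exact hz (g3 (support_fderiv_subset ℝ hne))
    simp [this]

theorem HasWeakDirDeriv.ae_eq (hΩ : IsOpen Ω) (ha : LocallyIntegrable a volume)
    (hb : LocallyIntegrable b volume) (h : HasWeakDirDeriv Ω f a e)
    (h' : HasWeakDirDeriv Ω f b e) : ∀ᵐ z, z ∈ Ω → a z = b z := by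
  have := hΩ.ae_eq_zero_of_integral_contDiff_smul_eq_zero
    ((ha.sub hb).locallyIntegrableOn Ω) fun φ h1 h2 h3 => by
      have i1 := ha.integrable_smul_left_of_hasCompactSupport h1.continuous h2
      have i2 := hb.integrable_smul_left_of_hasCompactSupport h1.continuous h2
      simp only [Pi.sub_apply, smul_sub]
      rw [integral_sub i1 i2, sub_eq_zero, ← neg_inj, ← h φ h1 h2 h3, ← h' φ h1 h2 h3]
  filter_upwards [this] with z hz hzΩ
  exact sub_eq_zero.1 (hz hzΩ)

theorem exists_exhaustion (hΩ : IsOpen Ω) : ∃ O : ℕ → Set ℂ, Monotone O ∧ (∀ n, IsOpen (O n)) ∧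
    (∀ n, IsCompact (closure (O n))) ∧ (∀ n, closure (O n) ⊆ Ω) ∧
    ∀ C ⊆ Ω, IsCompact C → ∃ n, C ⊆ O n := by
  -- Extended distances cover `Ω = ℂ`, where the distance to the empty complement is `⊤`. The set `O
  -- 0` is empty.
  let O : ℕ → Set ℂ := fun n => Metric.ball 0 n ∩ {z | (n : ENNReal)⁻¹ < Metric.infEDist z Ωᶜ}
  have hcont : Continuous fun z : ℂ => Metric.infEDist z Ωᶜ := Metric.continuous_infEDist
  have hmono : Monotone O := by
    intro m n hmn z hz
    have h2 : (m : ENNReal)⁻¹ < Metric.infEDist z Ωᶜ := hz.2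
    exact ⟨Metric.ball_subset_ball (by exact_mod_cast hmn) hz.1,
      (ENNReal.inv_le_inv.2 (by exact_mod_cast hmn)).trans_lt h2⟩
  have hopen : ∀ n, IsOpen (O n) := fun n =>
    Metric.isOpen_ball.inter (isOpen_lt continuous_const hcont)
  have hsub : ∀ n, closure (O n) ⊆
      Metric.closedBall 0 n ∩ {z | (n : ENNReal)⁻¹ ≤ Metric.infEDist z Ωᶜ} := fun n =>
    closure_minimal (fun z hz => ⟨Metric.ball_subset_closedBall hz.1, le_of_lt (mem_ofPred.1 hz.2)⟩)
      (Metric.isClosed_closedBall.inter (isClosed_le continuous_const hcont))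
  refine ⟨O, hmono, hopen, fun n => ?_, fun n z hz => ?_, fun C hC hCc => ?_⟩
  · exact (isCompact_closedBall (0 : ℂ) (n : ℝ)).of_isClosed_subset isClosed_closure
      fun z hz => (hsub n hz).1
  · by_contra hzΩ
    have h0 : Metric.infEDist z Ωᶜ = 0 := Metric.infEDist_zero_of_mem hzΩ
    have := (hsub n hz).2
    rw [mem_ofPred_eq, h0] at this
    simp at this
  · refine hCc.elim_directed_cover O hopen (fun z hz => ?_) hmono.directed_le
    have h0 : Metric.infEDist z Ωᶜ ≠ 0 := fun h => by
      have := Metric.mem_iff_infEDist_zero_of_closed (isClosed_compl_iff.2 hΩ) |>.2 h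
      exact this (hC hz)
    obtain ⟨n, hn⟩ := ENNReal.exists_inv_nat_lt h0
    obtain ⟨m, hm⟩ := exists_nat_gt ‖z‖
    refine mem_iUnion.2 ⟨max n m, ?_, ?_⟩
    · rw [mem_ball_zero_iff]
      exact hm.trans_le (by exact_mod_cast le_max_right _ _)
    · refine lt_of_le_of_lt (ENNReal.inv_le_inv.2 ?_) hn
      exact_mod_cast le_max_left _ _

/-- A function is weakly differentiable on `Ω` in a direction, with derivative in `L²_loc`, if its
products with test functions have bounded difference quotients in `L²`. -/
theorem MemL2loc.exists_hasWeakDirDeriv (hΩ : IsOpen Ω) (hf : MemL2loc Ω f) (e : ℂ)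
    (h : ∀ (η : ℂ → ℝ) (hη : IsTest Ω η), ∃ C : ℝ, ∀ᶠ t : ℝ in 𝓝[≠] 0,
      ‖translate (t • e) (hη.memLp_smul hf).toLp - (hη.memLp_smul hf).toLp‖ ≤ C * |t|) :
    ∃ a : ℂ → ℂ, MemL2loc Ω a ∧ HasWeakDirDeriv Ω f a e := by
  classical
  obtain ⟨O, hmono, hopen, hcomp, hsub, hex⟩ := exists_exhaustion hΩ
  have hloc : ∀ n, ∃ v : L2, HasWeakDirDeriv (O n) f v e := by
    intro n
    obtain ⟨η, U, hη, hU, hKU, -, hη1⟩ := exists_isTest_eq_one hΩ (hcomp n) (hsub n)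
    obtain ⟨C, hC⟩ := h η hη
    obtain ⟨v, hv⟩ := Beltrami.exists_hasWeakDirDeriv hC
    refine ⟨v, HasWeakDirDeriv.of_cutoff (η := η) (fun z hz => hη1 z (hKU (subset_closure hz)))
      (hv.congr_ae (MemLp.coeFn_toLp _) (EventuallyEq.refl _ _))⟩
  choose v hv using hloc
  have hcompat : ∀ᵐ z, ∀ m n, m ≤ n → z ∈ O m → v m z = v n z := by
    rw [ae_all_iff]; intro m
    rw [ae_all_iff]; intro n
    by_cases hmn : m ≤ n
    · have h' : HasWeakDirDeriv (O m) f (v n) e := fun φ h1 h2 h3 =>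
        hv n φ h1 h2 (h3.trans (hmono hmn))
      filter_upwards [(hv m).ae_eq (hopen m) (locallyIntegrable_L2 _) (locallyIntegrable_L2 _) h']
        with z hz _ using hz
    · exact Eventually.of_forall fun z h => absurd h hmn
  -- The local derivatives agree a.e. on overlaps, so taking the least admissible index glues them
  -- up to a null set.
  let a : ℂ → ℂ := fun z => if hz : ∃ n, z ∈ O n then v (Nat.find hz) z else 0
  have ha : ∀ᵐ z, ∀ n, z ∈ O n → a z = v n z := by
    filter_upwards [hcompat] with z hz n hn
    have hz' : ∃ n, z ∈ O n := ⟨n, hn⟩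
    simp only [a, dif_pos hz']
    exact hz _ _ (Nat.find_min' hz' hn) (Nat.find_spec hz')
  refine ⟨a, fun C hC hCc => ?_, fun φ h1 h2 h3 => ?_⟩
  · obtain ⟨n, hn⟩ := hex C hC hCc
    refine ((Lp.memLp (v n)).restrict C).ae_eq ?_
    filter_upwards [ae_restrict_of_ae ha, ae_restrict_mem hCc.measurableSet] with z hz hzC
    exact (hz n (hn hzC)).symm
  · obtain ⟨n, hn⟩ := hex _ h3 h2
    rw [hv n φ h1 h2 hn, neg_inj]
    refine integral_congr_ae ?_
    filter_upwards [ha] with z hz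
    by_cases hzn : z ∈ O n
    · rw [hz n hzn]
    · have : φ z = 0 := image_eq_zero_of_notMem_tsupport fun h => hzn (hn h)
      simp [this]

/-! ### Pointwise limits of difference quotients. -/

theorem eventually_smul_add_mem {K U : Set ℂ} (hK : IsCompact K) (hU : IsOpen U) (h : K ⊆ U)
    (e : ℂ) : ∀ᶠ t : ℝ in 𝓝 0, ∀ z ∈ K, t • e + z ∈ U := by
  obtain ⟨δ, hδ, hsub⟩ := hK.exists_thickening_subset_open hU h
  have ht : Tendsto (fun t : ℝ => ‖t • e‖) (𝓝 0) (𝓝 0) := by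
    have : Continuous fun t : ℝ => ‖t • e‖ := by fun_prop
    simpa using this.tendsto 0
  filter_upwards [ht.eventually_lt_const hδ] with t ht z hz
  exact hsub (Metric.mem_thickening_iff.2 ⟨z, hz, by simpa [dist_eq_norm] using ht⟩)

theorem ae_comp_add_left {P : ℂ → Prop} (h : ∀ᵐ z : ℂ, P z) (a : ℂ) : ∀ᵐ z : ℂ, P (a + z) :=
  (measurePreserving_add_left volume a).quasiMeasurePreserving.ae h

/-- Difference quotients along a sequence converge almost everywhere. -/
theorem exists_seq_tendsto_difference_quotient {u v : L2} (h : HasWeakDirDeriv univ u v e)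
    {s : ℕ → ℝ} (hs : Tendsto s atTop (𝓝[≠] 0)) :
    ∃ ns : ℕ → ℕ, StrictMono ns ∧ ∀ᵐ z, Tendsto
      (fun i => (s (ns i))⁻¹ • (u (s (ns i) • e + z) - u z)) atTop (𝓝 (v z)) := by
  obtain ⟨ns, hns, hlim⟩ := (tendstoInMeasure_of_tendsto_Lp
    ((tendsto_difference_quotient h).comp hs)).exists_seq_tendsto_ae
  refine ⟨ns, hns, ?_⟩
  have hcoe : ∀ᵐ z, ∀ n : ℕ, (s n)⁻¹ • (u (s n • e + z) - u z) =
      ((fun t : ℝ => t⁻¹ • (Beltrami.translate (t • e) u - u)) ∘ s) n z := by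
    rw [ae_all_iff]
    intro n
    filter_upwards [translate_ae_eq (s n • e) u,
      Lp.coeFn_sub (Beltrami.translate (s n • e) u) u,
      Lp.coeFn_smul (s n)⁻¹ (Beltrami.translate (s n • e) u - u)] with z h1 h2 h3
    rw [Function.comp_apply, h3, Pi.smul_apply, h2, Pi.sub_apply, h1]
  filter_upwards [hlim, hcoe] with z h1 h2
  exact h1.congr fun i => (h2 (ns i)).symm

/-- Weak derivatives of a Lipschitz image are controlled by the weak derivatives. -/
theorem ae_norm_le_of_lipschitz (hΩ : IsOpen Ω) {k : ℝ≥0} {H : ℂ → ℂ} (hH : LipschitzWith k H)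
    (hf : MemL2loc Ω f) (hg : MemL2loc Ω g) (ha : MemL2loc Ω a) (hb : MemL2loc Ω b)
    (hfa : HasWeakDirDeriv Ω f a e) (hgb : HasWeakDirDeriv Ω g b e)
    (h : ∀ᵐ z ∂(volume.restrict Ω), g z = H (f z)) :
    ∀ᵐ z ∂(volume.restrict Ω), ‖b z‖ ≤ k * ‖a z‖ := by
  rw [ae_restrict_iff' hΩ.measurableSet] at h ⊢
  obtain ⟨O, -, -, hcomp, hsub, hex⟩ := exists_exhaustion hΩ
  have hloc : ∀ n, ∀ᵐ z, z ∈ O n → ‖b z‖ ≤ k * ‖a z‖ := by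
    intro n
    obtain ⟨η, U, hη, hU, hKU, hUΩ, hη1⟩ := exists_isTest_eq_one hΩ (hcomp n) (hsub n)
    have d1 := (hfa.test_smul hf ha hη).congr_ae (hη.memLp_smul hf).coeFn_toLp.symm
      (hη.memLp_smul_add hf ha e).coeFn_toLp.symm
    have d2 := (hgb.test_smul hg hb hη).congr_ae (hη.memLp_smul hg).coeFn_toLp.symm
      (hη.memLp_smul_add hg hb e).coeFn_toLp.symm
    set s : ℕ → ℝ := fun n => 1 / ((n : ℝ) + 1)
    have hs : Tendsto s atTop (𝓝[≠] 0) :=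
      tendsto_nhdsWithin_of_tendsto_nhds_of_eventually_within _
        tendsto_one_div_add_atTop_nhds_zero_nat
        (Eventually.of_forall fun n => (Nat.one_div_pos_of_nat (α := ℝ)).ne')
    -- A subsequence for `f`, then a further one for `g`. Countably many steps also let a.e.
    -- identities hold at all the translated points at once.
    obtain ⟨ns, hns, hl1⟩ := exists_seq_tendsto_difference_quotient d1 hs
    obtain ⟨ms, hms, hl2⟩ := exists_seq_tendsto_difference_quotient d2
      (hs.comp hns.tendsto_atTop)
    set t : ℕ → ℝ := fun i => s (ns (ms i)) with ht
    have ht0 : Tendsto t atTop (𝓝 0) := (hs.comp (hns.tendsto_atTop.comp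
      hms.tendsto_atTop)).mono_right nhdsWithin_le_nhds
    have c1 := (hη.memLp_smul hf).coeFn_toLp
    have c2 := (hη.memLp_smul hg).coeFn_toLp
    have c1' := ae_all_iff.2 fun i => ae_comp_add_left c1 (t i • e)
    have c2' := ae_all_iff.2 fun i => ae_comp_add_left c2 (t i • e)
    have h' := ae_all_iff.2 fun i => ae_comp_add_left h (t i • e)
    filter_upwards [hl1, hl2, c1, c2, c1', c2', h, h', (hη.memLp_smul_add hf ha e).coeFn_toLp,
      (hη.memLp_smul_add hg hb e).coeFn_toLp] with z hl1 hl2 c1 c2 c1' c2' h h' c3 c4 hz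
    have hzU : z ∈ U := hKU (subset_closure hz)
    have hev : ∀ᶠ i in atTop, t i • e + z ∈ U :=
      (ht0.eventually (eventually_smul_add_mem isCompact_singleton hU
        (singleton_subset_iff.2 hzU) e)).mono fun i hi => hi z rfl
    have hd := fderiv_eq_zero_of_eq_one hU hη1 hzU
    simp only [hd, hη1 z hzU, one_smul, zero_apply, zero_smul, add_zero] at c1 c2 c3 c4
    have l1 := (hl1.comp hms.tendsto_atTop).norm.const_mul (k : ℝ)
    have l2 := hl2.norm
    rw [c3] at l1
    rw [c4] at l2
    refine le_of_tendsto_of_tendsto l2 l1 ?_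
    filter_upwards [hev] with i hi
    have e1 := c1' i
    have e2 := c2' i
    simp only [hη1 _ hi, one_smul] at e1 e2
    simp only [Function.comp_apply, norm_smul]
    rw [show s (ns (ms i)) = t i from rfl, e1, e2, c1, c2, h (hUΩ hzU), h' i (hUΩ hi), mul_left_comm]
    exact mul_le_mul_of_nonneg_left (by simpa [dist_eq_norm] using hH.dist_le_mul _ _)
      (norm_nonneg _)
  filter_upwards [ae_all_iff.2 hloc] with z hz hzΩ
  obtain ⟨n, hn⟩ := hex {z} (singleton_subset_iff.2 hzΩ) isCompact_singleton
  exact hz n (hn rfl)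

/-! ### The Caccioppoli estimate and the difference quotient bound. -/

theorem norm_toLp_le_mul (hf : MemLp f 2 volume) (hg : MemLp g 2 volume) {c : ℝ}
    (h : ∀ᵐ z, ‖f z‖ ≤ c * ‖g z‖) : ‖hf.toLp f‖ ≤ c * ‖hg.toLp g‖ := by
  refine Lp.norm_le_mul_norm_of_ae_le_mul ?_
  filter_upwards [h, hf.coeFn_toLp, hg.coeFn_toLp] with z h1 h2 h3
  rwa [h2, h3]

theorem norm_sub_I_mul_toLp_eq {u p q : ℂ → ℂ} (hu : MemLp u 2 volume)
    (hp : MemLp p 2 volume) (hq : MemLp q 2 volume) (h1 : HasWeakDirDeriv univ u p 1)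
    (hI : HasWeakDirDeriv univ u q Complex.I) :
    ‖(hp.sub (hq.const_smul Complex.I)).toLp‖ = ‖(hp.add (hq.const_smul Complex.I)).toLp‖ := by
  rw [MemLp.toLp_sub hp (hq.const_smul Complex.I), MemLp.toLp_add hp (hq.const_smul Complex.I),
    MemLp.toLp_const_smul Complex.I hq]
  exact norm_sub_I_smul_eq (h1.congr_ae hu.coeFn_toLp.symm hp.coeFn_toLp.symm)
    (hI.congr_ae hu.coeFn_toLp.symm hq.coeFn_toLp.symm)

/-- Difference quotients of the product with a test function. -/
theorem norm_translate_test_smul_sub_le {M : ℝ}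
    (hM : ∀ x y, |η x - η y| ≤ M * ‖x - y‖) {ζ : ℂ → ℂ} (hζ : MemLp ζ 2 volume)
    (hηζ : MemLp (fun z => η z • ζ z) 2 volume) (c : ℂ)
    (hA : MemLp (fun z => η z • (ζ (c + z) - ζ z)) 2 volume) :
    ‖translate c hηζ.toLp - hηζ.toLp‖ ≤ ‖hA.toLp‖ + M * ‖c‖ * ‖hζ.toLp‖ := by
  -- Discrete Leibniz rule; membership in `L²` follows by solving it for this term.
  have hT : MemLp (fun z => (η (c + z) - η z) • ζ (c + z)) 2 volume := by
    refine ((memLp_translate hηζ c).sub (hηζ.add hA)).ae_eq (Eventually.of_forall fun z => ?_)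
    simp only [Pi.sub_apply, Pi.add_apply, smul_sub, sub_smul]
    ring
  have h1 : translate c hηζ.toLp - hηζ.toLp = hA.toLp + hT.toLp := by
    rw [translate_toLp, ← MemLp.toLp_sub, ← MemLp.toLp_add]
    refine MemLp.toLp_congr _ _ (Eventually.of_forall fun z => ?_)
    simp only [Pi.sub_apply, Pi.add_apply, smul_sub, sub_smul]
    ring
  rw [h1]
  refine (norm_add_le _ _).trans (add_le_add_right ?_ _)
  rw [← (translate c).norm_map (hζ.toLp), translate_toLp]
  refine norm_toLp_le_mul _ _ (Eventually.of_forall fun z => ?_)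
  rw [norm_smul]
  exact mul_le_mul_of_nonneg_right (by simpa using hM (c + z) z) (norm_nonneg _)

/-- A Caccioppoli estimate for quasiregular functions. -/
theorem caccioppoli {u p q : ℂ → ℂ} (hu : MemLp u 2 volume)
    (hp : MemLp p 2 volume) (hq : MemLp q 2 volume) (h1 : HasWeakDirDeriv univ u p 1)
    (hI : HasWeakDirDeriv univ u q Complex.I) (hη : IsTest univ η) {M : ℝ}
    (hM1 : ∀ z, |fderiv ℝ η z 1| ≤ M) (hMI : ∀ z, |fderiv ℝ η z Complex.I| ≤ M) {k : ℝ}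
    (hA : MemLp (fun z => η z • (p z - Complex.I * q z)) 2 volume)
    (hB : MemLp (fun z => η z • (p z + Complex.I * q z)) 2 volume)
    (h : ∀ᵐ z, ‖η z • (p z + Complex.I * q z)‖ ≤ k * ‖η z • (p z - Complex.I * q z)‖) :
    (1 - k) * ‖hA.toLp‖ ≤ 4 * M * ‖hu.toLp‖ := by
  have lu : MemL2loc univ u := .of_memLp hu
  have lp : MemL2loc univ p := .of_memLp hp
  have lq : MemL2loc univ q := .of_memLp hq
  -- The norm identity for `ηu` reads `‖A + R‖ = ‖B + S‖`, where `R`, `S` carry the derivatives of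
  -- `η`. Each has two terms bounded by `M |u|`, whence `4 M`, and `‖B‖ ≤ k ‖A‖` is absorbed.
  have key := norm_sub_I_mul_toLp_eq (hη.memLp_smul lu) (hη.memLp_smul_add lu lp 1)
    (hη.memLp_smul_add lu lq Complex.I) (h1.test_smul lu lp hη) (hI.test_smul lu lq hη)
  have m1 := (hη.fderiv_apply 1).memLp_smul lu
  have mI := ((hη.fderiv_apply Complex.I).memLp_smul lu).const_mul Complex.I
  have hR := m1.sub mI
  have hS := m1.add mI
  have bound : ∀ z, ‖fderiv ℝ η z 1 • u z‖ ≤ M * ‖u z‖ ∧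
      ‖Complex.I * fderiv ℝ η z Complex.I • u z‖ ≤ M * ‖u z‖ := by
    intro z
    constructor
    · rw [norm_smul]
      exact mul_le_mul_of_nonneg_right (hM1 z) (norm_nonneg _)
    · rw [norm_mul, Complex.norm_I, one_mul, norm_smul]
      exact mul_le_mul_of_nonneg_right (hMI z) (norm_nonneg _)
  have nR : ‖hR.toLp‖ ≤ 2 * M * ‖hu.toLp‖ := norm_toLp_le_mul _ _ (Eventually.of_forall fun z => by
    refine (norm_sub_le _ _).trans ?_
    linarith [(bound z).1, (bound z).2])
  have nS : ‖hS.toLp‖ ≤ 2 * M * ‖hu.toLp‖ := norm_toLp_le_mul _ _ (Eventually.of_forall fun z => by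
    refine (norm_add_le _ _).trans ?_
    linarith [(bound z).1, (bound z).2])
  have nB : ‖hB.toLp‖ ≤ k * ‖hA.toLp‖ := norm_toLp_le_mul _ _ h
  have eA : ‖hA.toLp + hR.toLp‖ = ‖hB.toLp + hS.toLp‖ := by
    rw [← MemLp.toLp_add, ← MemLp.toLp_add]
    refine Eq.trans (congrArg _ (MemLp.toLp_congr _ _ (Eventually.of_forall fun z => ?_)))
      (key.trans (congrArg _ (MemLp.toLp_congr _ _ (Eventually.of_forall fun z => ?_))))
    · simp only [Pi.sub_apply, Pi.add_apply, Pi.smul_apply, smul_eq_mul, Complex.real_smul]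
      ring
    · simp only [Pi.add_apply, Pi.smul_apply, smul_eq_mul, Complex.real_smul]
      ring
  have i1 : ‖hA.toLp‖ ≤ ‖hA.toLp + hR.toLp‖ + ‖hR.toLp‖ := by
    simpa using norm_sub_le (hA.toLp + hR.toLp) hR.toLp
  have i2 := norm_add_le hB.toLp hS.toLp
  linarith

theorem HasWeakDirDeriv.difference (hf : MemLp f 2 volume) (ha : MemLp a 2 volume)
    (h : HasWeakDirDeriv univ f a e) (c : ℂ) :
    HasWeakDirDeriv univ (fun z => f (c + z) - f z) (fun z => a (c + z) - a z) e := by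
  have := HasWeakDirDeriv.add (.of_memLp (memLp_translate hf c)) (.const_mul (.of_memLp hf) (-1))
    (.of_memLp (memLp_translate ha c)) (.const_mul (.of_memLp ha) (-1)) (h.translate c)
    (h.const_mul (-1))
  simpa [← sub_eq_add_neg] using this

/-- The Wirtinger derivatives of a `W^{1,2}_loc` solution of an autonomous Beltrami equation have
bounded difference quotients. -/
theorem exists_bound_difference_wirtinger {k : ℝ≥0} (hk : k < 1) {H : ℂ → ℂ}
    (hΩ : IsOpen Ω) (hH : LipschitzWith k H) {F : ℂ → ℂ} {DF : ℂ → ℂ →L[ℝ] ℂ}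
    (hF : HasW12locDifferential Ω F DF)
    (hsol : ∀ᵐ z ∂(volume.restrict Ω), dzbar (DF z) = H (dz (DF z))) (e : ℂ) (hη : IsTest Ω η)
    (hf : MemL2loc Ω fun z => dz (DF z)) (hg : MemL2loc Ω fun z => dzbar (DF z)) :
    ∃ C : ℝ, ∀ᶠ t : ℝ in 𝓝[≠] 0,
      ‖translate (t • e) (hη.memLp_smul hf).toLp - (hη.memLp_smul hf).toLp‖ ≤ C * |t| ∧
      ‖translate (t • e) (hη.memLp_smul hg).toLp - (hη.memLp_smul hg).toLp‖ ≤ C * |t| := by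
  rw [ae_restrict_iff' hΩ.measurableSet] at hsol
  obtain ⟨χ, U, hχ, hU, hKU, hUΩ, hχ1⟩ := exists_isTest_eq_one hΩ hη.2.isCompact hη.3
  have lD : ∀ v, MemL2loc Ω fun z => DF z v := hF.memL2loc_differential.clm_apply
  -- `Φ = χF` is defined on the plane with global `L²` derivatives and has the same differential as
  -- `F` on `U`, a neighbourhood of the support of `η`.
  obtain ⟨Φ, P, mΦ, mP, dP, eP⟩ : ∃ (Φ : ℂ → ℂ) (P : ℂ → ℂ → ℂ), MemLp Φ 2 volume ∧
      (∀ v, MemLp (P v) 2 volume) ∧ (∀ v, HasWeakDirDeriv univ Φ (P v) v) ∧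
      ∀ v, ∀ z ∈ U, P v z = DF z v :=
    ⟨fun z => χ z • F z, fun v z => χ z • DF z v + fderiv ℝ χ z v • F z,
      hχ.memLp_smul hF.memL2loc, fun v => hχ.memLp_smul_add hF.memL2loc (lD v) v,
      fun v => (hF.hasWeakDirDeriv v).test_smul hF.memL2loc (lD v) hχ,
      fun v z hz => by simp [hχ1 z hz, fderiv_eq_zero_of_eq_one hU hχ1 hz]⟩
  -- `ζ` and `θ` are twice the Wirtinger derivatives of `Φ`; the factor is undone by `half` and by
  -- the `/ 2` in the final constant.
  obtain ⟨ζ, hζ⟩ : ∃ ζ : ℂ → ℂ, ∀ z, ζ z = P 1 z - Complex.I * P Complex.I z := ⟨_, fun _ => rfl⟩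
  obtain ⟨θ, hθ⟩ : ∃ θ : ℂ → ℂ, ∀ z, θ z = P 1 z + Complex.I * P Complex.I z := ⟨_, fun _ => rfl⟩
  have mζ : MemLp ζ 2 volume :=
    ((mP 1).sub ((mP Complex.I).const_mul _)).ae_eq (Eventually.of_forall fun z => (hζ z).symm)
  have mθ : MemLp θ 2 volume :=
    ((mP 1).add ((mP Complex.I).const_mul _)).ae_eq (Eventually.of_forall fun z => (hθ z).symm)
  have eζ : ∀ z ∈ U, ζ z = 2 * dz (DF z) := fun z hz => by
    rw [hζ, eP _ z hz, eP _ z hz, dz]; ring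
  have eθ : ∀ z ∈ U, θ z = 2 * dzbar (DF z) := fun z hz => by
    rw [hθ, eP _ z hz, eP _ z hz, dzbar]; ring
  obtain ⟨M1, hM1⟩ := (hη.fderiv_apply 1).exists_abs_le
  obtain ⟨M2, hM2⟩ := (hη.fderiv_apply Complex.I).exists_abs_le
  obtain ⟨M, hM⟩ := hη.exists_abs_sub_le
  have hk1 : 0 < 1 - (k : ℝ) := sub_pos.2 (by exact_mod_cast hk)
  have hηu := hη.univ
  have mηζ := hηu.memLp_smul (.of_memLp mζ)
  have mηθ := hηu.memLp_smul (.of_memLp mθ)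
  set Ψ : L2 := (mP e).toLp
  have hΨ : HasWeakDirDeriv univ mΦ.toLp Ψ e :=
    (dP e).congr_ae mΦ.coeFn_toLp.symm (mP e).coeFn_toLp.symm
  have half : ∀ {ξ h : ℂ → ℂ} (_ : ∀ z ∈ U, ξ z = 2 * h z)
      (m1 : MemLp (fun z => η z • ξ z) 2 volume) (m2 : MemLp (fun z => η z • h z) 2 volume),
      m1.toLp = (2 : ℂ) • m2.toLp := by
    intro ξ h hξ m1 m2
    rw [← MemLp.toLp_const_smul]
    refine MemLp.toLp_congr _ _ (Eventually.of_forall fun z => ?_)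
    by_cases hz : z ∈ tsupport η
    · simp only [hξ z (hKU hz), Pi.smul_apply, smul_eq_mul, Complex.real_smul]
      ring
    · simp [image_eq_zero_of_notMem_tsupport hz]
  have hh1 := half eζ mηζ (hη.memLp_smul hf)
  have hh2 := half eθ mηθ (hη.memLp_smul hg)
  -- `N` is the Caccioppoli constant times the bound `‖Ψ‖` for the difference quotient of `Φ`. `C1`
  -- and `C2` add the error from translating `η`.
  set N : ℝ := (1 - (k : ℝ))⁻¹ * (4 * max M1 M2 * ‖Ψ‖)
  set C1 : ℝ := N + M * ‖e‖ * ‖mζ.toLp‖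
  set C2 : ℝ := k * N + M * ‖e‖ * ‖mθ.toLp‖
  refine ⟨max C1 C2 / 2, ?_⟩
  have hev : ∀ᶠ t : ℝ in 𝓝[≠] 0, ∀ z ∈ tsupport η, t • e + z ∈ U :=
    (eventually_smul_add_mem hη.2.isCompact hU hKU e).filter_mono nhdsWithin_le_nhds
  filter_upwards [hev] with t ht
  have mu := (memLp_translate mΦ (t • e)).sub mΦ
  have mp : ∀ v, MemLp (fun z => P v (t • e + z) - P v z) 2 volume :=
    fun v => (memLp_translate (mP v) (t • e)).sub (mP v)
  have dp := fun v => (dP v).difference mΦ (mP v) (t • e)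
  have mA : MemLp (fun z => η z • (ζ (t • e + z) - ζ z)) 2 volume := hηu.memLp_smul (.of_memLp ((memLp_translate mζ (t • e)).sub mζ))
  have mB : MemLp (fun z => η z • (θ (t • e + z) - θ z)) 2 volume := hηu.memLp_smul (.of_memLp ((memLp_translate mθ (t • e)).sub mθ))
  -- Autonomy enters here: the same `H` governs both points, so the difference of solutions inherits
  -- the bound `k`.
  have hae : ∀ᵐ z, ‖η z • (θ (t • e + z) - θ z)‖ ≤ k * ‖η z • (ζ (t • e + z) - ζ z)‖ := by
    filter_upwards [hsol, ae_comp_add_left hsol (t • e)] with z h1 h2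
    by_cases hz : z ∈ tsupport η
    · have z1 := hKU hz
      have z2 := ht z hz
      rw [eθ _ z1, eθ _ z2, eζ _ z1, eζ _ z2, h1 (hUΩ z1), h2 (hUΩ z2), ← mul_sub, ← mul_sub]
      simp only [norm_smul, norm_mul]
      have := hH.dist_le_mul (dz (DF (t • e + z))) (dz (DF z))
      rw [dist_eq_norm, dist_eq_norm] at this
      refine (mul_le_mul_of_nonneg_left (mul_le_mul_of_nonneg_left this (norm_nonneg _))
        (norm_nonneg _)).trans_eq (by ring)
    · simp [image_eq_zero_of_notMem_tsupport hz]
  have fA : ∀ z, η z • (ζ (t • e + z) - ζ z) = η z • ((P 1 (t • e + z) - P 1 z) -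
      Complex.I * (P Complex.I (t • e + z) - P Complex.I z)) := fun z => by
    simp only [hζ]; ring_nf
  have fB : ∀ z, η z • (θ (t • e + z) - θ z) = η z • ((P 1 (t • e + z) - P 1 z) +
      Complex.I * (P Complex.I (t • e + z) - P Complex.I z)) := fun z => by
    simp only [hθ]; ring_nf
  have mA' := mA.ae_eq (Eventually.of_forall fA)
  have mB' := mB.ae_eq (Eventually.of_forall fB)
  have cac := caccioppoli mu (mp 1) (mp Complex.I) (dp 1) (dp Complex.I) hηu
    (M := max M1 M2) (fun z => (hM1 z).trans (le_max_left _ _))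
    (fun z => (hM2 z).trans (le_max_right _ _)) mA' mB' (k := k)
    (by filter_upwards [hae] with z hz; rwa [← fA, ← fB])
  have nu : ‖mu.toLp‖ ≤ |t| * ‖Ψ‖ := by
    rw [MemLp.toLp_sub (memLp_translate mΦ (t • e)) mΦ, ← translate_toLp]
    exact norm_translate_sub_le hΨ t
  have hM0 : 0 ≤ max M1 M2 := (abs_nonneg _).trans ((hM1 0).trans (le_max_left _ _))
  have nA : ‖mA.toLp‖ ≤ N * |t| := by
    have : mA.toLp = mA'.toLp := MemLp.toLp_congr _ _ (Eventually.of_forall fA)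
    rw [this]
    have h1 : (1 - (k : ℝ)) * ‖mA'.toLp‖ ≤ 4 * max M1 M2 * (|t| * ‖Ψ‖) :=
      cac.trans (mul_le_mul_of_nonneg_left nu (by positivity))
    rw [← le_inv_mul_iff₀ hk1] at h1
    calc _ ≤ _ := h1
      _ = N * |t| := by simp only [N]; ring
  have nB : ‖mB.toLp‖ ≤ k * (N * |t|) :=
    (norm_toLp_le_mul mB mA hae).trans (mul_le_mul_of_nonneg_left nA k.2)
  have r1 := norm_translate_test_smul_sub_le hM mζ mηζ (t • e) mA
  have r2 := norm_translate_test_smul_sub_le hM mθ mηθ (t • e) mB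
  rw [hh1, map_smul, ← smul_sub, norm_smul, norm_smul, Real.norm_eq_abs] at r1
  rw [hh2, map_smul, ← smul_sub, norm_smul, norm_smul, Real.norm_eq_abs] at r2
  have n2 : ‖(2 : ℂ)‖ = 2 := by simp
  rw [n2] at r1 r2
  have k1 : (N + M * ‖e‖ * ‖mζ.toLp‖) * |t| ≤ max C1 C2 * |t| :=
    mul_le_mul_of_nonneg_right (le_max_left _ _) (abs_nonneg t)
  have k2 : (k * N + M * ‖e‖ * ‖mθ.toLp‖) * |t| ≤ max C1 C2 * |t| :=
    mul_le_mul_of_nonneg_right (le_max_right _ _) (abs_nonneg t)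
  constructor <;> linarith

/-! ### Linear algebra of Wirtinger derivatives. -/

/-- The real linear map with given Wirtinger derivatives. -/
noncomputable def ofWirtinger : ℂ × ℂ →L[ℝ] ℂ →L[ℝ] ℂ :=
  ((ContinuousLinearMap.mul ℝ ℂ).comp (ContinuousLinearMap.fst ℝ ℂ ℂ)) +
    ((((ContinuousLinearMap.compL ℝ ℂ ℂ ℂ).flip (Complex.conjCLE : ℂ →L[ℝ] ℂ)).comp
      (ContinuousLinearMap.mul ℝ ℂ)).comp (ContinuousLinearMap.snd ℝ ℂ ℂ))

@[simp]
theorem ofWirtinger_apply (a b z : ℂ) :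
    ofWirtinger (a, b) z = a * z + b * (starRingEnd ℂ) z := by
  simp [ofWirtinger]

theorem eq_ofWirtinger (L : ℂ →L[ℝ] ℂ) : L = ofWirtinger (dz L, dzbar L) := by
  ext z
  have hz : z = z.re + z.im * Complex.I := (Complex.re_add_im z).symm
  have hc : (starRingEnd ℂ) z = z.re - z.im * Complex.I := by
    apply Complex.ext <;> simp
  have hL : L z = z.re * L 1 + z.im * L Complex.I := by
    have h : z = z.re • (1 : ℂ) + z.im • Complex.I := by simp
    conv_lhs => rw [h]
    rw [map_add, map_smul, map_smul, Complex.real_smul, Complex.real_smul]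
  rw [hL, ofWirtinger_apply, hc, dz, dzbar]
  linear_combination (-(L 1 - Complex.I * L Complex.I) / 2) * hz +
    z.im * L Complex.I * Complex.I_sq

theorem norm_ofWirtinger_le (a b : ℂ) : ‖ofWirtinger (a, b)‖ ≤ ‖a‖ + ‖b‖ := by
  refine ContinuousLinearMap.opNorm_le_bound _ (by positivity) fun z => ?_
  rw [ofWirtinger_apply]
  refine (norm_add_le _ _).trans ?_
  simp [add_mul]

theorem det_ofWirtinger (a b : ℂ) : (ofWirtinger (a, b)).det = ‖a‖ ^ 2 - ‖b‖ ^ 2 := by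
  rw [ContinuousLinearMap.det, ← LinearMap.det_toMatrix Complex.basisOneI, Matrix.det_fin_two]
  simp [LinearMap.toMatrix_apply, Complex.sq_norm, Complex.normSq_apply]
  ring

/-- The distortion inequality in terms of Wirtinger derivatives. -/
theorem norm_ofWirtinger_sq_le {k : ℝ} (hk : k < 1) {a b : ℂ} (h : ‖b‖ ≤ k * ‖a‖) :
    ‖ofWirtinger (a, b)‖ ^ 2 ≤ (1 + k) / (1 - k) * (ofWirtinger (a, b)).det := by
  have hk' : 0 < 1 - k := sub_pos.2 hk
  have h1 : ‖ofWirtinger (a, b)‖ ^ 2 ≤ (‖a‖ + ‖b‖) ^ 2 :=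
    pow_le_pow_left₀ (norm_nonneg _) (norm_ofWirtinger_le a b) 2
  refine h1.trans ?_
  rw [det_ofWirtinger, div_mul_eq_mul_div, le_div_iff₀ hk']
  -- Twice this product is exactly the difference of the two sides of the goal.
  have h2 : 0 ≤ (‖a‖ + ‖b‖) * (k * ‖a‖ - ‖b‖) :=
    mul_nonneg (by positivity) (sub_nonneg.2 h)
  nlinarith

/-! ### Commuting weak derivatives and the conclusion. -/

/-- Weak mixed second derivatives commute. -/
theorem HasWeakDirDeriv.swap {F : ℂ → ℂ} {e v : ℂ} {Fe Fv S : ℂ → ℂ}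
    (he : HasWeakDirDeriv Ω F Fe e) (hv : HasWeakDirDeriv Ω F Fv v)
    (hS : HasWeakDirDeriv Ω Fv S e) : HasWeakDirDeriv Ω Fe S v := by
  intro φ h1 h2 h3
  have hφ : IsTest Ω φ := ⟨h1, h2, h3⟩
  have te := hφ.fderiv_apply e
  have tv := hφ.fderiv_apply v
  rw [← hS φ h1 h2 h3, ← neg_inj, ← he _ tv.1 tv.2 tv.3, ← hv _ te.1 te.2 te.3]
  congr 1
  ext z
  congr 1
  have hd : DifferentiableAt ℝ (fderiv ℝ φ) z :=
    (h1.fderiv_right (m := ∞) (by simp)).differentiable (by simp) z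
  rw [fderiv_clm_apply hd (differentiableAt_const _), fderiv_clm_apply hd (differentiableAt_const _)]
  have hsym : IsSymmSndFDerivAt ℝ φ z := h1.contDiffAt.isSymmSndFDerivAt (by
    simp only [minSmoothness_of_isRCLikeNormedField]
    exact WithTop.coe_le_coe.2 (le_top : (2 : ℕ∞) ≤ ⊤))
  simpa using hsym e v

end Beltrami

open Beltrami Filter in
theorem proposition2p1 (Ω : Set ℂ) (hΩ : IsOpen Ω)
    (k : ℝ≥0) (hk : k < 1) (H : ℂ → ℂ) (hH : LipschitzWith k H)
    (F : ℂ → ℂ) (DF : ℂ → ℂ →L[ℝ] ℂ) (hF : Beltrami.HasW12locDifferential Ω F DF)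
    (hsol : ∀ᵐ z ∂(volume.restrict Ω), Beltrami.dzbar (DF z) = H (Beltrami.dz (DF z)))
    (e : ℂ) (he : ‖e‖ = 1) :
    Beltrami.MemW12loc Ω (fun z => DF z e) ∧
      Beltrami.IsQuasiregular ((1 + (k : ℝ)) / (1 - (k : ℝ))) Ω (fun z => DF z e) := by
  have lD : ∀ v, MemL2loc Ω fun z => DF z v := hF.memL2loc_differential.clm_apply
  have hf : MemL2loc Ω fun z => dz (DF z) := by
    convert (((lD 1).add ((lD Complex.I).const_mul (-Complex.I))).const_mul (1 / 2)) using 2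
    rw [dz]; ring
  have hg : MemL2loc Ω fun z => dzbar (DF z) := by
    convert (((lD 1).add ((lD Complex.I).const_mul Complex.I)).const_mul (1 / 2)) using 2
    rw [dzbar]; ring
  obtain ⟨a, ha, hfa⟩ := hf.exists_hasWeakDirDeriv hΩ e fun η hη => by
    obtain ⟨C, hC⟩ := exists_bound_difference_wirtinger hk hΩ hH hF hsol e hη hf hg
    exact ⟨C, hC.mono fun t ht => ht.1⟩
  obtain ⟨b, hb, hgb⟩ := hg.exists_hasWeakDirDeriv hΩ e fun η hη => by
    obtain ⟨C, hC⟩ := exists_bound_difference_wirtinger hk hΩ hH hF hsol e hη hf hg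
    exact ⟨C, hC.mono fun t ht => ht.2⟩
  have hab := ae_norm_le_of_lipschitz hΩ hH hf hg ha hb hfa hgb hsol
  have hk1 : (k : ℝ) < 1 := by exact_mod_cast hk
  have hW : HasW12locDifferential Ω (fun z => DF z e) fun z => ofWirtinger (a z, b z) := by
    refine ⟨lD e, fun C hC hCc => ?_, fun v => ?_⟩
    · have h1 := (ContinuousLinearMap.inl ℝ ℂ ℂ).comp_memLp' (ha C hC hCc)
      have h2 := (ContinuousLinearMap.inr ℝ ℂ ℂ).comp_memLp' (hb C hC hCc)
      exact ofWirtinger.comp_memLp' ((h1.add h2).ae_eq (Eventually.of_forall fun z => by simp))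
    -- It suffices to differentiate `∂_v F = v ∂_z F + v̄ ∂_z̄ F` in the fixed direction `e`, which
    -- gives `v a + v̄ b`.
    · refine (hF.hasWeakDirDeriv e).swap (hF.hasWeakDirDeriv v) ?_
      have h := HasWeakDirDeriv.add (hf.const_mul v) (hg.const_mul ((starRingEnd ℂ) v))
        (ha.const_mul v) (hb.const_mul ((starRingEnd ℂ) v)) (hfa.const_mul v) (hgb.const_mul _)
      convert h using 2 with z z
      · conv_lhs => rw [eq_ofWirtinger (DF z)]
        rw [ofWirtinger_apply]
        ring
      · rw [ofWirtinger_apply]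
        ring
  refine ⟨⟨_, hW⟩, ?_, _, hW, ?_⟩
  · rw [le_div_iff₀ (sub_pos.2 hk1)]
    linarith [k.2, NNReal.coe_nonneg k]
  · filter_upwards [hab] with z hz
    exact norm_ofWirtinger_sq_le hk1 hz
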